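/- Let $X$ be a finite-dimensional real vector space. A geometric graph $G=(V,E)$ in $X$ consists of a set $V\subseteq X$ of vertices and a set $E$ of edges, each edge $[v,w]$ joining two distinct members $v,w$ of $V$. A function $f\colon V\to X$ is a decomposing function for $G$ if $f(v)-f(w)$ is a scalar multiple of $v-w$ for every edge $[v,w]\in E$. The graph $G$ is indecomposable if every non-constant decomposing function for $G$ is the restriction to $V$ of a homothety $y\mapsto \alpha y+x$ with $\alpha\in\mathbb R\setminus\{0\}$, $x\in X$. The union of geometric graphs has as vertices and edges the unions of their vertex sets and of their edge sets. A polytope $P\subseteq X$ is the convex hull of a finite set of points; its dimension is that of its affine hull, and its skeleton is the geometric graph formed by its vertices and edges. $P$ is indecomposable if it is not the Minkowski sum $Q+R$ of two convex bodies $Q,R$ (nonempty compact convex sets), neither of them a single point, that are not similar, i.e. for which $Q$ is not of the form $cR+x$ with $c>0$ and $x\in X$. (i) Let $H=(V,E)$ be an indecomposable geometric graph in $X$ and, for each edge $e=[u,v]\in E$, let $G_e=(V_e,E_e)$ be an indecomposable geometric graph in $X$ with $u,v\in V_e$. Then the union $\bigcup_{e\in E}G_e$ is an indecomposable geometric graph.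 (ii) Let $n\ge 1$, let $G_1=(V_1,E_1),\dots,G_n=(V_n,E_n)$ be indecomposable geometric graphs in $X$ and let $v_1,\dots,v_n\in X$ be affinely independent. Set $G_0=G_n$ (so $V_0=V_n$) and suppose that $v_i\in V_i\cap V_{i-1}$ for each $i=1,\dots,n$. Then the union $G_1\cup G_2\cup\dots\cup G_n$ is indecomposable. (iii) Let $P\subseteq X$ be a polytope of dimension $d$, let $G_1=(V_1,E_1)$ and $G_2=(V_2,E_2)$ be two indecomposable subgraphs of the skeleton of $P$ with $V_1\cap V_2\neq\emptyset$, and suppose that $V_1\cup V_2$ contains all but at most $d-2$ vertices of $P$. Then $P$ is indecomposable. -/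

import Mathlib

open scoped Pointwise

/-- A geometric graph in `X`: a set of points of `X` together with a set of edges, each joining
two distinct members of that set (a subgraph of the complete graph on the points of `X`).
Unions of geometric graphs are the suprema `⊔`, `⨆` of subgraphs, "is a subgraph of" is `≤`. -/
abbrev GeometricGraph (X : Type*) := (⊤ : SimpleGraph X).Subgraph

namespace GeometricGraph

variable {X : Type*} [AddCommGroup X] [Module ℝ X]

/-- `f` is a decomposing function for `G`. Only the restriction of `f` to the vertex set matters
(both here and in `IsIndecomposable`); functions on the vertex set are written as functions
on `X` whose values elsewhere are irrelevant. -/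
def IsDecomposing (G : GeometricGraph X) (f : X → X) : Prop :=
  ∀ v w : X, G.Adj v w → ∃ c : ℝ, f v - f w = c • (v - w)

/-- `f` is constant on the vertices of `G`. -/
def IsConstantOnVerts (G : GeometricGraph X) (f : X → X) : Prop :=
  ∃ x : X, ∀ v ∈ G.verts, f v = x

/-- On the vertices of `G`, `f` is the restriction of a homothety of `X`
(with a positive or negative ratio). -/
def IsHomothetyOnVerts (G : GeometricGraph X) (f : X → X) : Prop :=
  ∃ a : ℝ, a ≠ 0 ∧ ∃ x : X, ∀ v ∈ G.verts, f v = a • v + x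

/-- The only non-constant decomposing functions of `G` are homotheties. -/
def IsIndecomposable (G : GeometricGraph X) : Prop :=
  ∀ f : X → X, G.IsDecomposing f → ¬ G.IsConstantOnVerts f → G.IsHomothetyOnVerts f

end GeometricGraph

namespace Polytope

variable {X : Type*} [NormedAddCommGroup X] [NormedSpace ℝ X]

/-- A polytope: the convex hull of a finite set of points. -/
def IsPolytope (P : Set X) : Prop :=
  ∃ s : Finset X, P = convexHull ℝ (s : Set X)

/-- The dimension of `P`, i.e. the dimension of its affine hull. -/
noncomputable def dim (P : Set X) : ℕ :=
  Module.finrank ℝ (vectorSpan ℝ P)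

/-- The skeleton of `P`: the geometric graph formed by the vertices (extreme points) of `P` and
its edges (the segments joining two vertices that are faces of `P`, i.e. that are cut out
of `P` by a supporting hyperplane, or are all of `P`). -/
def skeleton (P : Set X) : GeometricGraph X where
  verts := P.extremePoints ℝ
  Adj u v := u ∈ P.extremePoints ℝ ∧ v ∈ P.extremePoints ℝ ∧ u ≠ v ∧
    IsExposed ℝ P (segment ℝ u v)
  adj_sub h := h.2.2.1
  edge_vert h := h.1
  symm := ⟨fun u v h => ⟨h.2.1, h.1, h.2.2.1.symm, segment_symm ℝ u v ▸ h.2.2.2⟩⟩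

/-- Two sets are similar if one is obtained from the other by a dilation (of positive ratio)
followed by a translation. -/
def Similar (Q R : Set X) : Prop :=
  ∃ c : ℝ, 0 < c ∧ ∃ x : X, Q = (fun y => c • y + x) '' R

/-- `P` is decomposable if it is the Minkowski sum of two convex bodies that are not similar.
Single points are excluded as summands, since every `P` is trivially the sum of a point and
a translate of `P`. -/
def IsDecomposable (P : Set X) : Prop :=
  ∃ Q R : ConvexBody X, (Q : Set X).Nontrivial ∧ (R : Set X).Nontrivial ∧
    P = (Q : Set X) + (R : Set X) ∧ ¬ Similar (Q : Set X) (R : Set X)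

/-- `P` is indecomposable (with respect to Minkowski addition). -/
def IsIndecomposable (P : Set X) : Prop := ¬ IsDecomposable P

end Polytope

/-!
A decomposing function multiplies the differences of the vertices of an indecomposable piece by a
common ratio. The ratios of two pieces agree if the pieces share two points, or if they are joined
along an affinely independent cycle: the increments of the function sum to zero around such a cycle,
which forces equal ratios. Three vertices of a polytope are never collinear, so triangles of
vertices are such cycles.

For (iii), let `v` be a common vertex of `G₁` and `G₂`. By Balinski's theorem the skeleton of `P`
remains connected after deleting `v` and the at most `d - 2` uncovered vertices, so it has an edge
between `G₁` and `G₂` that forms a triangle with `v`. Likewise an uncovered vertex has two covered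
neighbours. Hence a decomposing function of the skeleton has a ratio on all vertices. Now if
`P = Q + R`, then writing each vertex as a sum of a point of `Q` and a point of `R` gives a
decomposing function, whose ratio makes `Q` similar to `P`, and by symmetry `R` as well.
-/

/-- `HasRatioOn f a s` says that on `s` the map `f` multiplies all differences by `a`, that is, it
agrees there with some `y ↦ a • y + x`: a homothety if `a ≠ 0`, a constant if `a = 0`. Decomposing
functions are those with a ratio on each edge, and indecomposable graphs those that force a common
ratio on all vertices. -/
def HasRatioOn {X : Type*} [AddCommGroup X] [Module ℝ X] (f : X → X) (a : ℝ) (s : Set X) : Prop :=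
  ∀ v ∈ s, ∀ w ∈ s, f v - f w = a • (v - w)

namespace HasRatioOn

variable {X : Type*} [AddCommGroup X] [Module ℝ X] {f : X → X} {a b c : ℝ} {s t : Set X}

theorem mono (hf : HasRatioOn f a t) (hst : s ⊆ t) : HasRatioOn f a s :=
  fun v hv w hw => hf v (hst hv) w (hst hw)

theorem exists_eq_smul_add (hf : HasRatioOn f a s) : ∃ x, ∀ v ∈ s, f v = a • v + x := by
  rcases s.eq_empty_or_nonempty with rfl | ⟨w, hw⟩
  · simp
  · exact ⟨f w - a • w, fun v hv => by linear_combination (norm := module) hf v hv w hw⟩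

theorem of_eq_smul_add {x : X} (hf : ∀ v ∈ s, f v = a • v + x) : HasRatioOn f a s := by
  intro v hv w hw
  rw [hf v hv, hf w hw]
  module

theorem pair {v w : X} (h : f v - f w = a • (v - w)) : HasRatioOn f a {v, w} :=
  of_eq_smul_add (x := f w - a • w) <| by
    rintro u (rfl | rfl)
    · linear_combination (norm := module) h
    · module

theorem eq_of_ne (hs : HasRatioOn f a s) (ht : HasRatioOn f b t) {v w : X} (hvw : v ≠ w)
    (hv : v ∈ s ∩ t) (hw : w ∈ s ∩ t) : a = b :=
  smul_left_injective ℝ (sub_ne_zero.2 hvw) <|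
    (hs v hv.1 w hw.1).symm.trans (ht v hv.2 w hw.2)

theorem extend (hs : HasRatioOn f a s) (h : ∀ w ∈ t, ∃ u ∈ s, f w - f u = a • (w - u)) :
    HasRatioOn f a t := by
  intro w hw z hz
  obtain ⟨u, hu, hwu⟩ := h w hw
  obtain ⟨v, hv, hzv⟩ := h z hz
  linear_combination (norm := module) hwu + hs u hu v hv - hzv

/-- Summing the increments of `f` around the cycle gives `∑ i, a i • (v (σ i) - v i) = 0`, an affine
dependence between the `v i` in which `v i` has the coefficient `a (σ⁻¹ i) - a i`. -/
theorem eq_of_perm {ι : Type*} [Finite ι] {v : ι → X} (hv : AffineIndependent ℝ v)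
    (σ : Equiv.Perm ι) {a : ι → ℝ} (hf : ∀ i, HasRatioOn f (a i) {v i, v (σ i)}) (i : ι) :
    a (σ i) = a i := by
  cases nonempty_fintype ι
  have hclosed : ∑ i, a i • (v (σ i) - v i) = 0 := by
    simp_rw [← fun i => hf i (v (σ i)) (Or.inr rfl) (v i) (Or.inl rfl), Finset.sum_sub_distrib,
      Equiv.sum_comp σ fun i => f (v i), sub_self]
  have hdep : ∑ i, a (σ.symm i) • v i = ∑ i, a i • v i := by
    rw [← Equiv.sum_comp σ, ← sub_eq_zero, ← Finset.sum_sub_distrib]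
    simpa [smul_sub] using hclosed
  simpa using (hv.eq_of_sum_eq_sum (Equiv.sum_comp σ.symm a) hdep (σ i) (Finset.mem_univ _)).symm

theorem eq_of_affineIndependent {p q r : X} (h : AffineIndependent ℝ ![p, q, r])
    (hpq : HasRatioOn f a {p, q}) (hqr : HasRatioOn f b {q, r}) (hrp : HasRatioOn f c {r, p}) :
    a = b :=
  (eq_of_perm h (finRotate 3) (a := ![a, b, c])
    (fun i => by fin_cases i <;> assumption) 0).symm

end HasRatioOn

open scoped Fin.CommRing in
theorem apply_eq_apply_zero_of_periodic {n : ℕ} [NeZero n] {β : Type*} {h : Fin n → β}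
    (hh : Function.Periodic h 1) (i : Fin n) : h i = h 0 := by
  simpa only [nsmul_one, Fin.cast_val_eq_self] using hh.nsmul_eq i

namespace GeometricGraph

variable {X : Type*} [AddCommGroup X] [Module ℝ X] {f : X → X}

theorem IsDecomposing.mono {G H : GeometricGraph X} (hf : H.IsDecomposing f) (h : G ≤ H) :
    G.IsDecomposing f :=
  fun v w hvw => hf v w (h.2 hvw)

theorem IsDecomposing.exists_hasRatioOn {G : GeometricGraph X} (hf : G.IsDecomposing f) {v w : X}
    (h : G.Adj v w) : ∃ c, HasRatioOn f c {v, w} :=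
  (hf v w h).imp fun _ => HasRatioOn.pair

theorem isIndecomposable_iff_exists_hasRatioOn {G : GeometricGraph X} :
    G.IsIndecomposable ↔ ∀ f, G.IsDecomposing f → ∃ a, HasRatioOn f a G.verts := by
  refine ⟨fun hG f hf => ?_, fun h f hf hconst => ?_⟩
  · by_cases hconst : G.IsConstantOnVerts f
    · obtain ⟨x, hx⟩ := hconst
      exact ⟨0, .of_eq_smul_add (x := x) fun v hv => by simp [hx v hv]⟩
    · obtain ⟨a, -, x, hx⟩ := hG f hf hconst
      exact ⟨a, .of_eq_smul_add hx⟩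
  · obtain ⟨a, ha⟩ := h f hf
    obtain ⟨x, hx⟩ := ha.exists_eq_smul_add
    refine ⟨a, ?_, x, hx⟩
    rintro rfl
    exact hconst ⟨x, fun v hv => by simp [hx v hv]⟩

theorem IsIndecomposable.exists_hasRatioOn_of_le {G H : GeometricGraph X} (hG : G.IsIndecomposable)
    (hGH : G ≤ H) (hf : H.IsDecomposing f) : ∃ a, HasRatioOn f a G.verts :=
  isIndecomposable_iff_exists_hasRatioOn.1 hG f (hf.mono hGH)

theorem isIndecomposable_iSup_edgeSet {H : GeometricGraph X} {G : H.edgeSet → GeometricGraph X}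
    (hH : H.IsIndecomposable) (hG : ∀ e, (G e).IsIndecomposable)
    (hmem : ∀ e : H.edgeSet, ∀ u ∈ (e : Sym2 X), u ∈ (G e).verts) :
    IsIndecomposable (⨆ e, G e) := by
  refine isIndecomposable_iff_exists_hasRatioOn.2 fun f hf => ?_
  choose a ha using fun e => (hG e).exists_hasRatioOn_of_le (le_iSup G e) hf
  have hends {v w : X} (h : H.Adj v w) : {v, w} ⊆ (G ⟨s(v, w), h⟩).verts :=
    Set.pair_subset (hmem _ v (Sym2.mem_mk_left v w)) (hmem _ w (Sym2.mem_mk_right v w))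
  have hfH : H.IsDecomposing f := fun v w h =>
    ⟨_, (ha _).mono (hends h) v (Or.inl rfl) w (Or.inr rfl)⟩
  obtain ⟨b, hb⟩ := hH.exists_hasRatioOn_of_le le_rfl hfH
  refine ⟨b, hb.extend fun x hx => ?_⟩
  rw [SimpleGraph.Subgraph.verts_iSup, Set.mem_iUnion] at hx
  obtain ⟨⟨⟨v, w⟩, h : H.Adj v w⟩, hx⟩ := hx
  have hv := hends h (Or.inl rfl)
  have hab := (ha _).eq_of_ne hb h.ne ⟨hv, h.fst_mem⟩ ⟨hends h (Or.inr rfl), h.snd_mem⟩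
  exact ⟨v, h.fst_mem, hab ▸ ha _ x hx v hv⟩

theorem isIndecomposable_iSup_cycle {n : ℕ} [NeZero n] {G : Fin n → GeometricGraph X}
    {v : Fin n → X} (hG : ∀ i, (G i).IsIndecomposable) (hv : AffineIndependent ℝ v)
    (hmem : ∀ i, v i ∈ (G i).verts ∩ (G (i - 1)).verts) :
    IsIndecomposable (⨆ i, G i) := by
  refine isIndecomposable_iff_exists_hasRatioOn.2 fun f hf => ?_
  choose a ha using fun i => (hG i).exists_hasRatioOn_of_le (le_iSup G i) hf
  have hmem_succ (i : Fin n) : v (i + 1) ∈ (G i).verts := by simpa using (hmem (i + 1)).2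
  have ha0 (i : Fin n) : a i = a 0 := apply_eq_apply_zero_of_periodic (HasRatioOn.eq_of_perm hv
    (Equiv.addRight 1) fun i => (ha i).mono (Set.pair_subset (hmem i).1 (hmem_succ i))) i
  simp only [ha0] at ha
  have hv0 (i : Fin n) : f (v i) - a 0 • v i = f (v 0) - a 0 • v 0 := by
    refine apply_eq_apply_zero_of_periodic (h := fun i => f (v i) - a 0 • v i) (fun i => ?_) i
    linear_combination (norm := module) ha i _ (hmem_succ i) _ (hmem i).1
  have hrange : HasRatioOn f (a 0) (Set.range v) := .of_eq_smul_add (x := f (v 0) - a 0 • v 0) <| by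
    rintro _ ⟨i, rfl⟩
    rw [← hv0 i]
    abel
  refine ⟨a 0, hrange.extend fun w hw => ?_⟩
  rw [SimpleGraph.Subgraph.verts_iSup, Set.mem_iUnion] at hw
  obtain ⟨i, hw⟩ := hw
  exact ⟨v i, Set.mem_range_self i, ha i w hw _ (hmem i).1⟩

end GeometricGraph

section Convexity

variable {E : Type*} [AddCommGroup E] [Module ℝ E] {s : Set E}

theorem not_wbtw_of_mem_extremePoints {p q r : E} (hp : p ∈ s) (hq : q ∈ s.extremePoints ℝ)
    (hr : r ∈ s) (hpq : p ≠ q) (hqr : q ≠ r) : ¬ Wbtw ℝ p q r := fun h =>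
  ((mem_extremePoints_iff_forall_segment.1 hq).2 p hp r hr (mem_segment_iff_wbtw.2 h)).elim hpq
    hqr.symm

theorem affineIndependent_of_mem_extremePoints {p q r : E} (hp : p ∈ s.extremePoints ℝ)
    (hq : q ∈ s.extremePoints ℝ) (hr : r ∈ s.extremePoints ℝ) (hpq : p ≠ q) (hqr : q ≠ r)
    (hrp : r ≠ p) : AffineIndependent ℝ ![p, q, r] := by
  rw [affineIndependent_iff_not_collinear_set]
  intro h
  rcases h.wbtw_or_wbtw_or_wbtw with h | h | h
  · exact not_wbtw_of_mem_extremePoints hp.1 hq hr.1 hpq hqr h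
  · exact not_wbtw_of_mem_extremePoints hq.1 hr hp.1 hqr hrp h
  · exact not_wbtw_of_mem_extremePoints hr.1 hp hq.1 hrp hpq h

variable [TopologicalSpace E]

theorem toExposed_convexHull {V : Set E} (hVs : V ⊆ s) (hV : V.Nonempty) {l : StrongDual ℝ E}
    {c : ℝ} (hc : ∀ v ∈ V, l v = c) (hlt : ∀ w ∈ s \ V, l w < c) :
    l.toExposed (convexHull ℝ s) = convexHull ℝ V := by
  have hle (y : E) (hy : y ∈ convexHull ℝ s) : l y ≤ c := by
    refine convexHull_min (fun w hw => ?_) (convex_halfSpace_le l.isLinear c) hy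
    by_cases hwV : w ∈ V
    exacts [(hc w hwV).le, (hlt w ⟨hw, hwV⟩).le]
  have hVc (y : E) (hy : y ∈ convexHull ℝ V) : l y = c :=
    convexHull_min hc (convex_hyperplane l.isLinear c) hy
  refine Set.Subset.antisymm (fun y ⟨hy, hmax⟩ => ?_) fun y hy =>
    ⟨convexHull_mono hVs hy, fun z hz => (hle z hz).trans (hVc y hy).ge⟩
  rcases (s \ V).eq_empty_or_nonempty with hW | hW
  · exact convexHull_mono (Set.sdiff_eq_empty.1 hW) hy
  rw [← Set.union_sdiff_cancel hVs, convexHull_union hV hW, mem_convexJoin] at hy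
  obtain ⟨x, hx, w, hw, a, b, -, hb, hab, rfl⟩ := hy
  have hlw : l w < c := convexHull_min hlt (convex_halfSpace_lt l.isLinear c) hw
  have hly : c ≤ l (a • x + b • w) := by
    obtain ⟨v, hv⟩ := hV
    exact (hc v hv).ge.trans (hmax v (subset_convexHull ℝ s (hVs hv)))
  obtain rfl := eq_sub_of_add_eq hab
  rw [map_add, map_smul, map_smul, hVc x hx, smul_eq_mul, smul_eq_mul] at hly
  obtain rfl : b = 0 := by nlinarith
  simpa using hx

variable [IsTopologicalAddGroup E] [ContinuousSMul ℝ E] [LocallyConvexSpace ℝ E]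

theorem exists_strongDual_pos_of_notMem {W : Submodule ℝ E} (hW : IsClosed (W : Set E)) {x : E}
    (hx : x ∉ W) : ∃ l : StrongDual ℝ E, (∀ w ∈ W, l w = 0) ∧ 0 < l x := by
  obtain ⟨l, c, hlt, hc⟩ := geometric_hahn_banach_closed_point W.convex hW hx
  have h0 : 0 < c := by simpa using hlt 0 W.zero_mem
  refine ⟨l, fun w hw => ?_, h0.trans hc⟩
  by_contra hne
  have := hlt _ (W.smul_mem (c / l w) hw)
  rw [map_smul, smul_eq_mul, div_mul_cancel₀ c hne] at this
  exact this.false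

variable [T2Space E]

theorem exists_mem_extremePoints_forall_le (hs : IsCompact s) (hne : s.Nonempty)
    (l : StrongDual ℝ E) : ∃ v ∈ s.extremePoints ℝ, ∀ y ∈ s, l y ≤ l v := by
  have hexp : IsExposed ℝ s (l.toExposed s) := ContinuousLinearMap.toExposed.isExposed
  obtain ⟨x, hx, hmax⟩ := hs.exists_isMaxOn hne l.continuous.continuousOn
  obtain ⟨v, hv⟩ := (hexp.isCompact hs).extremePoints_nonempty ⟨x, hx, fun y hy => hmax hy⟩
  exact ⟨v, hexp.isExtreme.extremePoints_subset_extremePoints hv, hv.1.2⟩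

theorem exists_forall_lt_of_mem_extremePoints_convexHull (hs : s.Finite) {z : E}
    (hz : z ∈ (convexHull ℝ s).extremePoints ℝ) :
    ∃ m : StrongDual ℝ E, ∀ u ∈ s, u ≠ z → m u < m z := by
  have hnot : z ∉ convexHull ℝ (s \ {z}) := fun h =>
    ((convex_convexHull ℝ s).mem_extremePoints_iff_mem_sdiff_convexHull_sdiff.1 hz).2
      (convexHull_mono (Set.sdiff_subset_sdiff_left (subset_convexHull ℝ s)) h)
  obtain ⟨m, c, hlt, hc⟩ := geometric_hahn_banach_closed_point (convex_convexHull ℝ _)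
    (hs.sdiff.isClosed_convexHull ℝ) hnot
  exact ⟨m, fun u hu huz => (hlt u (subset_convexHull ℝ _ ⟨hu, huz⟩)).trans hc⟩

end Convexity

theorem reachable_of_forall_exists_adj_lt {V α : Type*} [Preorder α] {G : SimpleGraph V}
    {U : Set V} (hU : U.Finite) (m : V → α) {M : V}
    (h : ∀ x ∈ U, x ≠ M → ∃ y ∈ U, G.Adj x y ∧ m x < m y) {x : V} (hx : x ∈ U) :
    G.Reachable x M := by
  by_contra hxM
  obtain ⟨z, ⟨hz, hzM⟩, hmax⟩ := (hU.sep fun z => ¬ G.Reachable z M).exists_maximalFor m _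
    ⟨x, hx, hxM⟩
  obtain ⟨y, hy, hzy, hlt⟩ := h z hz fun h => hzM (h ▸ .refl z)
  exact hlt.not_ge (hmax ⟨hy, fun hyM => hzM (hzy.reachable.trans hyM)⟩ hlt.le)

theorem exists_pos_forall_lt_imp_add_mul_lt {ι : Type*} {s : Set ι} (hs : s.Finite) (f g : ι → ℝ) :
    ∃ ε > 0, ∀ x ∈ s, ∀ y ∈ s, f x < f y → f x + ε * g x < f y + ε * g y := by
  have hlt (x y : ι) (h : f x < f y) :
      ∀ᶠ ε : ℝ in nhdsWithin 0 (Set.Ioi 0), f x + ε * g x < f y + ε * g y :=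
    nhdsWithin_le_nhds <| ContinuousAt.eventually_lt (by fun_prop) (by fun_prop) (by simpa using h)
  have hall : ∀ᶠ ε : ℝ in nhdsWithin 0 (Set.Ioi 0),
      ∀ x ∈ s, ∀ y ∈ s, f x < f y → f x + ε * g x < f y + ε * g y := by
    simp only [Filter.eventually_all_finite hs, Filter.eventually_imp_distrib_left]
    exact fun x _ y _ => hlt x y
  obtain ⟨ε, hε, h⟩ := (eventually_mem_nhdsWithin.and hall).exists
  exact ⟨ε, hε, h⟩

namespace Polytope

variable {X : Type*} [NormedAddCommGroup X] [NormedSpace ℝ X] {P : Set X}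

namespace IsPolytope

theorem convex (hP : IsPolytope P) : Convex ℝ P := by
  obtain ⟨s, rfl⟩ := hP
  exact convex_convexHull ℝ _

theorem isCompact (hP : IsPolytope P) : IsCompact P := by
  obtain ⟨s, rfl⟩ := hP
  exact s.finite_toSet.isCompact_convexHull ℝ

theorem finite_extremePoints (hP : IsPolytope P) : (P.extremePoints ℝ).Finite := by
  obtain ⟨s, rfl⟩ := hP
  exact s.finite_toSet.subset extremePoints_convexHull_subset

theorem convexHull_extremePoints (hP : IsPolytope P) : convexHull ℝ (P.extremePoints ℝ) = P := by
  rw [← (hP.finite_extremePoints.isClosed_convexHull ℝ).closure_eq,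
    closure_convexHull_extremePoints hP.isCompact hP.convex]

theorem exists_forall_lt (hP : IsPolytope P) {v : X} (hv : v ∈ P.extremePoints ℝ) :
    ∃ m : StrongDual ℝ X, ∀ u ∈ P.extremePoints ℝ, u ≠ v → m u < m v :=
  exists_forall_lt_of_mem_extremePoints_convexHull hP.finite_extremePoints <| by
    rwa [hP.convexHull_extremePoints]

theorem skeleton_adj (hP : IsPolytope P) {u v : X} (hu : u ∈ P.extremePoints ℝ)
    (hv : v ∈ P.extremePoints ℝ) (huv : u ≠ v) {l : StrongDual ℝ X} (hl : l u = l v)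
    (hlt : ∀ w ∈ P.extremePoints ℝ, w ≠ u → w ≠ v → l w < l v) : (skeleton P).Adj u v := by
  refine ⟨hu, hv, huv, ?_⟩
  have hface := toExposed_convexHull (s := P.extremePoints ℝ) (V := {u, v}) (l := l) (c := l v)
    (Set.pair_subset hu hv) (Set.insert_nonempty u {v}) (by simp [hl]) (by simpa using hlt)
  rw [hP.convexHull_extremePoints, convexHull_pair] at hface
  exact hface ▸ ContinuousLinearMap.toExposed.isExposed

end IsPolytope

section VertexFigure

/-- The central projection from `v` of the points `u` with `m u < m v` to a hyperplane parallel to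
the kernel of `m`, taken relative to `v`. If `v` is the only maximum point of `m` on a polytope,
then the projections of the other vertices span its vertex figure at `v`. -/
noncomputable def vertexFigureProj (m : StrongDual ℝ X) (v u : X) : X :=
  (m v - m u)⁻¹ • (u - v)

variable {m : StrongDual ℝ X} {u v : X}

theorem smul_vertexFigureProj (hu : m u < m v) :
    (m v - m u) • vertexFigureProj m v u = u - v :=
  smul_inv_smul₀ (sub_pos.2 hu).ne' _

theorem vertexFigureProj_injOn (hv : v ∈ P.extremePoints ℝ)
    (hm : ∀ u ∈ P.extremePoints ℝ, u ≠ v → m u < m v) :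
    Set.InjOn (vertexFigureProj m v) (P.extremePoints ℝ \ {v}) := by
  rintro u ⟨hu, huv⟩ w ⟨hw, hwv⟩ huw
  by_contra hne
  refine affineIndependent_iff_not_collinear_set.1
    (affineIndependent_of_mem_extremePoints hv hu hw (Ne.symm huv) hne hwv) ?_
  rw [collinear_iff_of_mem (Set.mem_insert v _)]
  refine ⟨vertexFigureProj m v u, ?_⟩
  rintro x (rfl | rfl | rfl)
  · exact ⟨0, by simp⟩
  · exact ⟨m v - m x, by simp [smul_vertexFigureProj (hm x hu huv)]⟩
  · exact ⟨m v - m x, by simp [huw, smul_vertexFigureProj (hm x hw hwv)]⟩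

theorem IsPolytope.skeleton_adj_of_vertexFigureProj_mem_extremePoints (hP : IsPolytope P)
    (hv : v ∈ P.extremePoints ℝ) (hm : ∀ u ∈ P.extremePoints ℝ, u ≠ v → m u < m v)
    (hu : u ∈ P.extremePoints ℝ \ {v})
    (hext : vertexFigureProj m v u ∈
      (convexHull ℝ (vertexFigureProj m v '' (P.extremePoints ℝ \ {v}))).extremePoints ℝ) :
    (skeleton P).Adj v u := by
  obtain ⟨k, hk⟩ := exists_forall_lt_of_mem_extremePoints_convexHull
    (hP.finite_extremePoints.sdiff.image _) hext
  -- Adding this multiple of `m` to `k` makes the edge from `v` to `u` horizontal.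
  let n : StrongDual ℝ X := k + k (vertexFigureProj m v u) • m
  have hn {w : X} (hw : w ∈ P.extremePoints ℝ \ {v}) : n w - n v =
      (m v - m w) * (k (vertexFigureProj m v w) - k (vertexFigureProj m v u)) := by
    have hkw := congrArg k (smul_vertexFigureProj (hm w hw.1 hw.2))
    simp only [map_smul, map_sub, smul_eq_mul] at hkw
    simp only [n, add_apply, smul_apply, smul_eq_mul]
    linear_combination -hkw
  have huv : n v = n u := by linear_combination -hn hu
  refine hP.skeleton_adj hv hu.1 (Ne.symm hu.2) huv fun w hw hwv hwu => ?_
  have hne : vertexFigureProj m v w ≠ vertexFigureProj m v u := fun h =>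
    hwu (vertexFigureProj_injOn hv hm ⟨hw, hwv⟩ hu h)
  rw [← huv, ← sub_neg, hn ⟨hw, hwv⟩]
  exact mul_neg_of_pos_of_neg (sub_pos.2 (hm w hw hwv))
    (sub_neg.2 (hk _ (Set.mem_image_of_mem _ ⟨hw, hwv⟩) hne))

theorem IsPolytope.exists_adj_lt (hP : IsPolytope P) (hv : v ∈ P.extremePoints ℝ) {p : X}
    (hp : p ∈ P) (l : StrongDual ℝ X) (hvp : l v < l p) :
    ∃ u, (skeleton P).Adj v u ∧ l v < l u := by
  obtain ⟨m, hm⟩ := hP.exists_forall_lt hv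
  have hproj {w : X} (hw : w ∈ P.extremePoints ℝ \ {v}) :
      (m v - m w) * l (vertexFigureProj m v w) = l w - l v := by
    simpa using congrArg l (smul_vertexFigureProj (hm w hw.1 hw.2))
  have hpos {w : X} (hw : w ∈ P.extremePoints ℝ \ {v}) :
      0 < l (vertexFigureProj m v w) ↔ l v < l w := by
    rw [← sub_pos (a := l w), ← hproj hw, mul_pos_iff_of_pos_left (sub_pos.2 (hm w hw.1 hw.2))]
  obtain ⟨w, hw, hwp⟩ := exists_mem_extremePoints_forall_le hP.isCompact ⟨p, hp⟩ l
  have hvw : l v < l w := hvp.trans_le (hwp p hp)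
  have hwv : w ∈ P.extremePoints ℝ \ {v} := ⟨hw, by rintro rfl; exact hvw.false⟩
  have hwK := subset_convexHull ℝ _ (Set.mem_image_of_mem (vertexFigureProj m v) hwv)
  obtain ⟨z, hz, hmax⟩ := exists_mem_extremePoints_forall_le
    ((hP.finite_extremePoints.sdiff.image _).isCompact_convexHull ℝ) ⟨_, hwK⟩ l
  obtain ⟨u, hu, rfl⟩ := extremePoints_convexHull_subset hz
  exact ⟨u, hP.skeleton_adj_of_vertexFigureProj_mem_extremePoints hv hm hu hz,
    (hpos hu).1 (((hpos hwv).2 hvw).trans_le (hmax _ hwK))⟩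

end VertexFigure

section Balinski

variable {S : Set X}

theorem exists_strongDual_eq_and_lt (hS : S.Finite) (hcard : S.ncard < dim P) (u : X) :
    ∃ l : StrongDual ℝ X, (∀ s ∈ S, l s = l u) ∧ ∃ p ∈ P, l u < l p := by
  let W : Submodule ℝ X := Submodule.span ℝ ((· - u) '' S)
  have hfin : ((· - u) '' S).Finite := hS.image _
  have : FiniteDimensional ℝ W := .span_of_finite ℝ hfin
  have hW : Module.finrank ℝ W ≤ S.ncard := by
    have := hfin.fintype
    refine (finrank_span_le_card _).trans ?_
    rw [← Set.ncard_eq_toFinset_card']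
    exact Set.ncard_image_le hS
  obtain ⟨p, hp, hpW⟩ : ∃ p ∈ P, p - u ∉ W := by
    by_contra! h
    refine (hW.trans_lt hcard).not_ge (Submodule.finrank_mono (Submodule.span_le.2 ?_))
    rintro _ ⟨p, hp, q, hq, rfl⟩
    simpa using W.sub_mem (h p hp) (h q hq)
  obtain ⟨l, hl, hlp⟩ := exists_strongDual_pos_of_notMem W.closed_of_finiteDimensional hpW
  refine ⟨l, fun s hs => ?_, p, hp, by simpa using hlp⟩
  simpa [sub_eq_zero] using hl _ (Submodule.subset_span (Set.mem_image_of_mem _ hs))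

namespace IsPolytope

theorem exists_adj_notMem (hP : IsPolytope P) {w : X} (hw : w ∈ P.extremePoints ℝ)
    (hS : S.Finite) (hcard : S.ncard < dim P) : ∃ u, (skeleton P).Adj w u ∧ u ∉ S := by
  obtain ⟨l, hl, p, hp, hlp⟩ := exists_strongDual_eq_and_lt hS hcard w
  obtain ⟨u, hwu, hlu⟩ := hP.exists_adj_lt hw hp l hlp
  exact ⟨u, hwu, fun hu => hlu.ne' (hl u hu)⟩

variable {l : StrongDual ℝ X} {c : ℝ} {x y : ((skeleton P).deleteVerts S).verts}

/- A functional that is generic near `l` has only one maximal vertex `M`, and climbing along it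
from above the hyperplane `l = c` never leads below. -/
theorem reachable_of_lt (hP : IsPolytope P) (hS : ∀ s ∈ S, l s ≤ c) (hx : c < l x) (hy : c < l y) :
    ((skeleton P).deleteVerts S).coe.Reachable x y := by
  have hnotMem {z : X} (hz : c < l z) : z ∉ S := fun hzS => hz.not_ge (hS z hzS)
  obtain ⟨M, hM, hMl⟩ := exists_mem_extremePoints_forall_le hP.isCompact ⟨x, x.2.1.1⟩ l
  obtain ⟨m₀, hm₀⟩ := hP.exists_forall_lt hM
  obtain ⟨ε, hε, hlt⟩ := exists_pos_forall_lt_imp_add_mul_lt hP.finite_extremePoints l m₀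
  let m : StrongDual ℝ X := l + ε • m₀
  let M' : ((skeleton P).deleteVerts S).verts := ⟨M, hM, hnotMem (hx.trans_le (hMl x x.2.1.1))⟩
  have hfin : ((skeleton P).deleteVerts S).verts.Finite := hP.finite_extremePoints.sdiff
  have hreach {z : ((skeleton P).deleteVerts S).verts} (hz : c < l z) :
      ((skeleton P).deleteVerts S).coe.Reachable z M' := by
    have := hfin.to_subtype
    refine reachable_of_forall_exists_adj_lt
      (Set.toFinite {z : ((skeleton P).deleteVerts S).verts | c < l z}) (fun z => m z) ?_ hz
    rintro ⟨z, hzP, hzS⟩ hz hzM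
    have hzm : m z < m M := add_lt_add_of_le_of_lt (hMl z hzP.1)
      (mul_lt_mul_of_pos_left (hm₀ z hzP fun h => hzM (Subtype.ext h)) hε)
    obtain ⟨w, hzw, hmw⟩ := hP.exists_adj_lt hzP hM.1 m hzm
    have hlw : c < l w := by
      refine lt_of_lt_of_le hz (le_of_not_gt fun hwz => ?_)
      exact hmw.asymm (hlt w hzw.2.1 z hzP hwz)
    exact ⟨⟨w, hzw.2.1, hnotMem hlw⟩, hlw, SimpleGraph.Subgraph.deleteVerts_adj.2
      ⟨hzP, hzS, hzw.2.1, hnotMem hlw, hzw⟩, hmw⟩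
  exact (hreach hx).trans (hreach hy).symm

theorem reachable_of_le (hP : IsPolytope P) (hS : ∀ s ∈ S, l s ≤ c) {p : X} (hp : p ∈ P)
    (hcp : c < l p) (hx : c ≤ l x) (hy : c ≤ l y) :
    ((skeleton P).deleteVerts S).coe.Reachable x y := by
  have hstep {z : ((skeleton P).deleteVerts S).verts} (hz : c ≤ l z) :
      ∃ w : ((skeleton P).deleteVerts S).verts,
        ((skeleton P).deleteVerts S).coe.Reachable z w ∧ c < l w := by
    rcases hz.lt_or_eq with hz | hz
    · exact ⟨z, .refl z, hz⟩
    · obtain ⟨w, hzw, hlw⟩ := hP.exists_adj_lt z.2.1 hp l (hz ▸ hcp)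
      have hwS : w ∉ S := fun hwS => (hz.trans_lt hlw).not_ge (hS w hwS)
      exact ⟨⟨w, hzw.2.1, hwS⟩, SimpleGraph.Adj.reachable <| SimpleGraph.Subgraph.deleteVerts_adj.2
        ⟨z.2.1, z.2.2, hzw.2.1, hwS, hzw⟩, hz.trans_lt hlw⟩
  obtain ⟨x', hxx', hx'⟩ := hstep hx
  obtain ⟨y', hyy', hy'⟩ := hstep hy
  exact hxx'.trans ((hP.reachable_of_lt hS hx' hy').trans hyy'.symm)

/-- Balinski's theorem. -/
theorem preconnected_deleteVerts (hP : IsPolytope P) (hS : S.Finite) (hcard : S.ncard < dim P) :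
    ((skeleton P).deleteVerts S).Preconnected := by
  refine ⟨fun u w => ?_⟩
  obtain ⟨l, hl, p, hp, hlp⟩ := exists_strongDual_eq_and_lt hS hcard (u : X)
  rcases le_or_gt (l u) (l w) with hle | hlt
  · exact hP.reachable_of_le (fun s hs => (hl s hs).le) hp hlp le_rfl hle
  · exact hP.reachable_of_le (l := -l) (c := -l u) (fun s hs => (neg_inj.2 (hl s hs)).le)
      w.2.1.1 (neg_lt_neg hlt) le_rfl (neg_le_neg hlt.le)

end IsPolytope

end Balinski

section DecomposingFunction

variable {f : X → X} {a b : ℝ} {S V W : Set X}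

theorem eq_of_hasRatioOn_of_skeleton_adj (hf : (skeleton P).IsDecomposing f)
    (hV : HasRatioOn f a V) (hW : HasRatioOn f b W) {v p q : X} (hv : v ∈ P.extremePoints ℝ)
    (hvVW : v ∈ V ∩ W) (hp : p ∈ V) (hq : q ∈ W) (hpv : p ≠ v) (hqv : q ≠ v)
    (hpq : (skeleton P).Adj p q) : a = b := by
  obtain ⟨c, hc⟩ := hf.exists_hasRatioOn hpq
  exact (HasRatioOn.eq_of_affineIndependent
    (affineIndependent_of_mem_extremePoints hpq.2.1 hv hpq.1 hqv hpv.symm hpq.ne)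
    (hW.mono (Set.pair_subset hq hvVW.2)) (hV.mono (Set.pair_subset hvVW.1 hp)) hc).symm

namespace IsPolytope

theorem exists_adj_mem_notMem (hP : IsPolytope P) (hS : S.Finite) (hcard : S.ncard < dim P)
    {u w : X} (hu : u ∈ P.extremePoints ℝ \ S) (hw : w ∈ P.extremePoints ℝ \ S) (huV : u ∈ V)
    (hwV : w ∉ V) : ∃ p q, (skeleton P).Adj p q ∧ p ∈ V \ S ∧ q ∉ V ∪ S := by
  obtain ⟨walk⟩ := (hP.preconnected_deleteVerts hS hcard).coe ⟨u, hu⟩ ⟨w, hw⟩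
  obtain ⟨d, -, hdV, hdV'⟩ := walk.exists_boundary_dart {x | (x : X) ∈ V} huV hwV
  obtain ⟨-, hdS, -, hdS', hadj⟩ := SimpleGraph.Subgraph.deleteVerts_adj.1 d.adj
  exact ⟨d.fst, d.snd, hadj, ⟨hdV, hdS⟩, not_or_intro hdV' hdS'⟩

theorem exists_hasRatioOn_union (hP : IsPolytope P) (hf : (skeleton P).IsDecomposing f)
    (hVP : V ⊆ P.extremePoints ℝ) (hWP : W ⊆ P.extremePoints ℝ) (hV : HasRatioOn f a V)
    (hW : HasRatioOn f b W) (hVW : (V ∩ W).Nonempty)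
    (hcard : (P.extremePoints ℝ \ (V ∪ W)).ncard + 2 ≤ dim P) : ∃ c, HasRatioOn f c (V ∪ W) := by
  obtain ⟨v, hv⟩ := hVW
  by_cases hsub : V ⊆ W
  · exact ⟨b, by rwa [Set.union_eq_right.2 hsub]⟩
  by_cases hsub' : W ⊆ V
  · exact ⟨a, by rwa [Set.union_eq_left.2 hsub']⟩
  obtain ⟨u, hu, huW⟩ := Set.not_subset.1 hsub
  obtain ⟨w, hw, hwV⟩ := Set.not_subset.1 hsub'
  let S := insert v (P.extremePoints ℝ \ (V ∪ W))
  have hS : S.ncard < dim P := (Set.ncard_insert_le _ _).trans_lt (by lia)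
  have huS : u ∉ S := by
    rintro (rfl | h)
    exacts [huW hv.2, h.2 (Or.inl hu)]
  have hwS : w ∉ S := by
    rintro (rfl | h)
    exacts [hwV hv.1, h.2 (Or.inr hw)]
  obtain ⟨p, q, hpq, ⟨hpV, hpS⟩, hq⟩ := hP.exists_adj_mem_notMem
    (hP.finite_extremePoints.sdiff.insert v) hS ⟨hVP hu, huS⟩ ⟨hWP hw, hwS⟩ hu hwV
  obtain ⟨hqV, hqS⟩ := not_or.1 hq
  have hqW : q ∈ W := by
    by_contra hqW
    exact hqS (Or.inr ⟨hpq.2.1, not_or_intro hqV hqW⟩)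
  obtain rfl : a = b := eq_of_hasRatioOn_of_skeleton_adj hf hV hW (hVP hv.1) hv hpV hqW
    (fun h => hpS (Or.inl h)) (fun h => hqS (Or.inl h)) hpq
  refine ⟨a, hV.extend fun x hx => ⟨v, hv.1, ?_⟩⟩
  exact hx.elim (fun hx => hV x hx v hv.1) fun hx => hW x hx v hv.2

theorem hasRatioOn_extremePoints (hP : IsPolytope P) (hf : (skeleton P).IsDecomposing f)
    (hV : HasRatioOn f a V) (hcard : (P.extremePoints ℝ \ V).ncard + 2 ≤ dim P) :
    HasRatioOn f a (P.extremePoints ℝ) := by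
  refine hV.extend fun w hw => ?_
  have hfin : (P.extremePoints ℝ \ V).Finite := hP.finite_extremePoints.sdiff
  have hmem {u : X} (hwu : (skeleton P).Adj w u) (hu : u ∉ P.extremePoints ℝ \ V) : u ∈ V := by
    by_contra huV
    exact hu ⟨hwu.2.1, huV⟩
  obtain ⟨u, hwu, hu⟩ := hP.exists_adj_notMem hw hfin (by lia)
  obtain ⟨u', hwu', hu'⟩ := hP.exists_adj_notMem hw (hfin.insert u)
    ((Set.ncard_insert_le _ _).trans_lt (by lia))
  obtain ⟨hne, hu'⟩ := not_or.1 hu'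
  obtain ⟨c, hc⟩ := hf.exists_hasRatioOn hwu
  obtain rfl : a = c := eq_of_hasRatioOn_of_skeleton_adj hf hV hc hwu.2.1
    ⟨hmem hwu hu, Or.inr rfl⟩ (hmem hwu' hu') (Or.inl rfl) hne hwu.ne hwu'.symm
  exact ⟨u, hmem hwu hu, hc w (Or.inl rfl) u (Or.inr rfl)⟩

theorem isIndecomposable_skeleton_of_union (hP : IsPolytope P) {G₁ G₂ : GeometricGraph X}
    (h₁ : G₁ ≤ skeleton P) (h₂ : G₂ ≤ skeleton P) (hG₁ : G₁.IsIndecomposable)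
    (hG₂ : G₂.IsIndecomposable) (hne : (G₁.verts ∩ G₂.verts).Nonempty)
    (hcard : (P.extremePoints ℝ \ (G₁.verts ∪ G₂.verts)).ncard + 2 ≤ dim P) :
    (skeleton P).IsIndecomposable := by
  refine GeometricGraph.isIndecomposable_iff_exists_hasRatioOn.2 fun f hf => ?_
  obtain ⟨a, ha⟩ := hG₁.exists_hasRatioOn_of_le h₁ hf
  obtain ⟨b, hb⟩ := hG₂.exists_hasRatioOn_of_le h₂ hf
  obtain ⟨c, hc⟩ := hP.exists_hasRatioOn_union hf h₁.1 h₂.1 ha hb hne hcard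
  exact ⟨c, hP.hasRatioOn_extremePoints hf hc hcard⟩

end IsPolytope

end DecomposingFunction

theorem Similar.symm {Q R : Set X} (h : Similar Q R) : Similar R Q := by
  obtain ⟨c, hc, x, rfl⟩ := h
  refine ⟨c⁻¹, inv_pos.2 hc, -(c⁻¹ • x), ?_⟩
  simp [Set.image_image, hc.ne']

theorem Similar.trans {Q R S : Set X} (hQR : Similar Q R) (hRS : Similar R S) : Similar Q S := by
  obtain ⟨c, hc, x, rfl⟩ := hQR
  obtain ⟨d, hd, y, rfl⟩ := hRS
  refine ⟨c * d, mul_pos hc hd, c • y + x, ?_⟩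
  simp only [Set.image_image, smul_add, smul_smul, add_assoc]

theorem similar_convexHull_image {f : X → X} {a : ℝ} {s : Set X} (ha : 0 < a)
    (hf : HasRatioOn f a s) : Similar (convexHull ℝ (f '' s)) (convexHull ℝ s) := by
  obtain ⟨x, hx⟩ := hf.exists_eq_smul_add
  refine ⟨a, ha, x, ?_⟩
  rw [Set.image_congr hx]
  exact ((a • AffineMap.id ℝ X + AffineMap.const ℝ X x).image_convexHull s).symm

/-- `f` splits every vertex `v` of the Minkowski sum `Q + R` into a point `f v` of `Q` and a point
`v - f v` of `R`. -/
def IsVertexSplitting (Q R : Set X) (f : X → X) : Prop :=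
  ∀ v ∈ (Q + R).extremePoints ℝ, f v ∈ Q ∧ v - f v ∈ R

theorem exists_isVertexSplitting (Q R : Set X) : ∃ f, IsVertexSplitting Q R f := by
  have hsplit : ∀ v ∈ (Q + R).extremePoints ℝ, ∃ q, q ∈ Q ∧ v - q ∈ R := by
    intro v hv
    obtain ⟨q, hq, r, hr, rfl⟩ := hv.1
    exact ⟨q, hq, by simpa using hr⟩
  choose! f hf using hsplit
  exact ⟨f, hf⟩

namespace IsVertexSplitting

variable {Q R : Set X} {f : X → X} {a : ℝ}

theorem symm (hf : IsVertexSplitting Q R f) : IsVertexSplitting R Q fun v => v - f v :=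
  fun v hv => by simpa using (hf v (add_comm R Q ▸ hv)).symm

/- Exchanging the summands of two adjacent vertices `v` and `w` gives two points of `Q + R` with the
same midpoint as `v` and `w`, hence two points of the edge. -/
theorem isDecomposing (hf : IsVertexSplitting Q R f) : (skeleton (Q + R)).IsDecomposing f := by
  rintro v w ⟨hv, hw, -, hedge⟩
  have hmid : midpoint ℝ v w ∈ openSegment ℝ (f v + (w - f w)) (f w + (v - f v)) :=
    ⟨1 / 2, 1 / 2, by norm_num, by norm_num, by norm_num, by
      rw [midpoint_eq_smul_add, invOf_eq_inv]
      module⟩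
  obtain ⟨a, b, -, -, hab, h⟩ := hedge.isExtreme.2 (Set.add_mem_add (hf v hv).1 (hf w hw).2)
    (Set.add_mem_add (hf w hw).1 (hf v hv).2) (midpoint_mem_segment v w) hmid
  obtain rfl := eq_sub_of_add_eq' hab
  exact ⟨a, by linear_combination (norm := module) -h⟩

theorem le_map (hf : IsVertexSplitting Q R f) {v : X} (hv : v ∈ (Q + R).extremePoints ℝ)
    {l : StrongDual ℝ X} (hmax : ∀ y ∈ Q + R, l y ≤ l v) {y : X} (hy : y ∈ Q) : l y ≤ l (f v) := by
  have h := hmax _ (Set.add_mem_add hy (hf v hv).2)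
  rw [map_add, map_sub] at h
  linarith

theorem convexHull_image (hf : IsVertexSplitting Q R f) (hP : IsPolytope (Q + R))
    (hQ : Convex ℝ Q) (hR : R.Nonempty) : convexHull ℝ (f '' (Q + R).extremePoints ℝ) = Q := by
  refine (convexHull_min ?_ hQ).antisymm fun y hy => ?_
  · rintro _ ⟨v, hv, rfl⟩
    exact (hf v hv).1
  · by_contra hnot
    obtain ⟨l, c, hlt, hc⟩ := geometric_hahn_banach_closed_point (convex_convexHull ℝ _)
      ((hP.finite_extremePoints.image f).isClosed_convexHull ℝ) hnot
    obtain ⟨v, hv, hmax⟩ := exists_mem_extremePoints_forall_le hP.isCompact (.add ⟨y, hy⟩ hR) l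
    exact ((hlt _ (subset_convexHull ℝ _ (Set.mem_image_of_mem f hv))).trans hc).not_ge
      (hf.le_map hv hmax hy)

theorem ratio_pos (hf : IsVertexSplitting Q R f) (hP : IsPolytope (Q + R)) (hQ : Q.Nontrivial)
    (hR : R.Nonempty) (ha : HasRatioOn f a ((Q + R).extremePoints ℝ)) : 0 < a := by
  obtain ⟨p, hp, q, hq, hpq⟩ := hQ
  obtain ⟨l, hl⟩ := geometric_hahn_banach_point_point hpq
  obtain ⟨v, hv, hmax⟩ := exists_mem_extremePoints_forall_le hP.isCompact (.add ⟨p, hp⟩ hR) l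
  obtain ⟨w, hw, hmin⟩ := exists_mem_extremePoints_forall_le hP.isCompact (.add ⟨p, hp⟩ hR) (-l)
  have hwp : l (f w) ≤ l p := neg_le_neg_iff.1 (hf.le_map hw hmin hp)
  have hwv : 0 ≤ l v - l w := sub_nonneg.2 (hmax w hw.1)
  have hratio : l (f v) - l (f w) = a * (l v - l w) := by
    simpa using congrArg l (ha v hv w hw)
  have hpos : 0 < a * (l v - l w) := hratio ▸ sub_pos.2 (hwp.trans_lt (hl.trans_le
    (hf.le_map hv hmax hq)))
  exact pos_of_mul_pos_left hpos hwv

theorem similar (hf : IsVertexSplitting Q R f) (hP : IsPolytope (Q + R)) (hQc : Convex ℝ Q)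
    (hQ : Q.Nontrivial) (hR : R.Nonempty) (ha : HasRatioOn f a ((Q + R).extremePoints ℝ)) :
    Similar Q (Q + R) := by
  have h := similar_convexHull_image (hf.ratio_pos hP hQ hR ha) ha
  rwa [hf.convexHull_image hP hQc hR, hP.convexHull_extremePoints] at h

end IsVertexSplitting

theorem IsPolytope.isIndecomposable_of_skeleton (hP : IsPolytope P)
    (h : (skeleton P).IsIndecomposable) : IsIndecomposable P := by
  rw [GeometricGraph.isIndecomposable_iff_exists_hasRatioOn] at h
  rintro ⟨Q, R, hQ, hR, rfl, hnot⟩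
  obtain ⟨f, hf⟩ := exists_isVertexSplitting (Q : Set X) R
  obtain ⟨a, ha⟩ := h f hf.isDecomposing
  have hQP := hf.similar hP Q.convex hQ hR.nonempty ha
  rw [add_comm] at hP hQP h
  obtain ⟨b, hb⟩ := h _ hf.symm.isDecomposing
  exact hnot (hQP.trans (hf.symm.similar hP R.convex hR hQ.nonempty hb).symm)

end Polytope

theorem theorem4_general {X : Type*} [NormedAddCommGroup X] [NormedSpace ℝ X] :
    -- (i)
    (∀ (H : GeometricGraph X) (G : H.edgeSet → GeometricGraph X),
      H.IsIndecomposable →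
      (∀ e : H.edgeSet, (G e).IsIndecomposable) →
      (∀ e : H.edgeSet, ∀ u ∈ (e : Sym2 X), u ∈ (G e).verts) →
      GeometricGraph.IsIndecomposable (⨆ e : H.edgeSet, G e)) ∧
    -- (ii)
    (∀ (n : ℕ) [NeZero n] (G : Fin n → GeometricGraph X) (v : Fin n → X),
      (∀ i : Fin n, (G i).IsIndecomposable) →
      AffineIndependent ℝ v →
      -- `i - 1` is the cyclic predecessor of `i`
      (∀ i : Fin n, v i ∈ (G i).verts ∩ (G (i - 1)).verts) →
      GeometricGraph.IsIndecomposable (⨆ i : Fin n, G i)) ∧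
    -- (iii)
    (∀ (P : Set X) (d : ℕ) (G₁ G₂ : GeometricGraph X),
      Polytope.IsPolytope P →
      Polytope.dim P = d →
      G₁ ≤ Polytope.skeleton P →
      G₂ ≤ Polytope.skeleton P →
      G₁.IsIndecomposable →
      G₂.IsIndecomposable →
      (G₁.verts ∩ G₂.verts).Nonempty →
      (((Polytope.skeleton P).verts \ (G₁.verts ∪ G₂.verts)).ncard : ℤ) ≤ (d : ℤ) - 2 →
      Polytope.IsIndecomposable P) := by
  refine ⟨fun _ _ => GeometricGraph.isIndecomposable_iSup_edgeSet,
    fun _ _ _ _ => GeometricGraph.isIndecomposable_iSup_cycle, ?_⟩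
  rintro P d G₁ G₂ hP rfl h₁ h₂ hG₁ hG₂ hne hcard
  change ((P.extremePoints ℝ \ _).ncard : ℤ) ≤ _ at hcard
  exact hP.isIndecomposable_of_skeleton
    (hP.isIndecomposable_skeleton_of_union h₁ h₂ hG₁ hG₂ hne (by lia))

theorem theorem4 {X : Type*} [NormedAddCommGroup X] [NormedSpace ℝ X] [FiniteDimensional ℝ X] :
    -- (i)
    (∀ (H : GeometricGraph X) (G : H.edgeSet → GeometricGraph X),
      H.IsIndecomposable →
      (∀ e : H.edgeSet, (G e).IsIndecomposable) →
      (∀ e : H.edgeSet, ∀ u ∈ (e : Sym2 X), u ∈ (G e).verts) →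
      GeometricGraph.IsIndecomposable (⨆ e : H.edgeSet, G e)) ∧
    -- (ii)
    (∀ (n : ℕ) [NeZero n] (G : Fin n → GeometricGraph X) (v : Fin n → X),
      (∀ i : Fin n, (G i).IsIndecomposable) →
      AffineIndependent ℝ v →
      -- `i - 1` is the cyclic predecessor of `i`
      (∀ i : Fin n, v i ∈ (G i).verts ∩ (G (i - 1)).verts) →
      GeometricGraph.IsIndecomposable (⨆ i : Fin n, G i)) ∧
    -- (iii)
    (∀ (P : Set X) (d : ℕ) (G₁ G₂ : GeometricGraph X),
      Polytope.IsPolytope P →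
      Polytope.dim P = d →
      G₁ ≤ Polytope.skeleton P →
      G₂ ≤ Polytope.skeleton P →
      G₁.IsIndecomposable →
      G₂.IsIndecomposable →
      (G₁.verts ∩ G₂.verts).Nonempty →
      (((Polytope.skeleton P).verts \ (G₁.verts ∪ G₂.verts)).ncard : ℤ) ≤ (d : ℤ) - 2 →
      Polytope.IsIndecomposable P) :=
  theorem4_general
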